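/- All tournaments are finite. The chromatic number $\chi(G)$ of a tournament $G$ is the least $k$ such that $V(G)$ is the union of $k$ sets each inducing an acyclic subtournament; for $A\subseteq V(G)$, $\chi(A)$ denotes $\chi(G[A])$. A pair $(A,B)$ of disjoint subsets of $V(G)$ is a complete pair if no edge of $G$ has its tail in $B$ and its head in $A$. For a real number $c\ge 0$, a tournament is $c$-good if it contains a complete pair $(A,B)$ with $\chi(A),\chi(B)\ge c$. For a numbering $v_1,\dots,v_n$ of $V(G)$, its local chromatic number is the maximum over $1\le i\le n$ of the chromatic number of the set of all $v_j$ such that either $j<i$ and $v_iv_j$ is an edge (directed from $v_i$ to $v_j$), or $j>i$ and $v_jv_i$ is an edge (directed from $v_j$ to $v_i$); it is $0$ if $n=0$. For an integer $\ell\ge 0$, let $\mathcal{C}_\ell$ be the class of all tournaments that admit a numbering with local chromatic number at most $\ell$. **Theorem.** Let $c\ge 0$ be real. Suppose that for every integer $\ell\ge 0$ there exists an integer $d\ge 0$ such that every tournament in $\mathcal{C}_\ell$ with chromatic number at least $d$ is $c$-good. Then there exists an integer $d\ge 0$ such that every tournament with chromatic number at least $d$ is $c$-good. Consequently, the following two statements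 are equivalent: (i) for every real $c\ge 0$ there exists $d$ such that every tournament with chromatic number at least $d$ is $c$-good; (ii) for every integer $\ell\ge 0$ and every real $c\ge 0$ there exists $d$ such that every tournament in $\mathcal{C}_\ell$ with chromatic number at least $d$ is $c$-good. -/

import Mathlib

universe u

/-- A tournament on the vertex type `V`: a loopless digraph in which any two distinct vertices
are joined by exactly one edge; `Adj v w` says that there is an edge with tail `v` and head `w`. -/
structure Tournament (V : Type u) extends Digraph V where
  irrefl : ∀ v, ¬ Adj v v
  exactly_one : ∀ v w, v ≠ w → Xor (Adj v w) (Adj w v)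

namespace Tournament

variable {V : Type u}

/-- The subtournament `G[A]` with vertex set `A`. -/
def induce (G : Tournament V) (A : Set V) : Tournament A where
  Adj v w := G.Adj v w
  irrefl v := G.irrefl v
  exactly_one v w h := G.exactly_one v w fun e => h (Subtype.ext e)

/-- `G` has no directed cycle: no nonempty directed walk returns to its starting vertex. -/
def Acyclic (G : Tournament V) : Prop :=
  ∀ v, ¬ Relation.TransGen G.Adj v v

/-- The least `k` such that the vertex set is the union of `k` subsets, each of which induces an
acyclic subtournament. (Such a `k` exists whenever `V` is finite.) -/
noncomputable def chromaticNumber (G : Tournament V) : ℕ :=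
  sInf {k : ℕ | ∃ A : Fin k → Set V, (⋃ i, A i) = Set.univ ∧ ∀ i, (G.induce (A i)).Acyclic}

/-- `χ(A) = χ(G[A])` for a set `A` of vertices. -/
noncomputable def chi (G : Tournament V) (A : Set V) : ℕ :=
  (G.induce A).chromaticNumber

/-- `(A, B)` is a complete pair: `A` and `B` are disjoint, and no edge has its tail in `B` and its
head in `A`. -/
def IsCompletePair (G : Tournament V) (A B : Set V) : Prop :=
  Disjoint A B ∧ ∀ a ∈ A, ∀ b ∈ B, ¬ G.Adj b a

/-- `G` contains a complete pair both of whose sides have chromatic number at least `c`. -/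
def IsGood (G : Tournament V) (c : ℝ) : Prop :=
  ∃ A B : Set V, G.IsCompletePair A B ∧ c ≤ (G.chi A : ℝ) ∧ c ≤ (G.chi B : ℝ)

/-- In the numbering `v`, the vertex `v j` is a forward in-neighbour of `v i`. -/
def IsForwardInNeighbour (G : Tournament V) {n : ℕ} (v : Fin n ≃ V) (i j : Fin n) : Prop :=
  i < j ∧ G.Adj (v j) (v i)

/-- In the numbering `v`, the vertex `v j` is a backward out-neighbour of `v i`. -/
def IsBackwardOutNeighbour (G : Tournament V) {n : ℕ} (v : Fin n ≃ V) (i j : Fin n) : Prop :=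
  G.IsForwardInNeighbour v j i

/-- The local chromatic number of a numbering `v` of the vertices: the maximum over all `i` of the
chromatic number of the set of all `v j` that are backward out-neighbours or forward in-neighbours
of `v i` (and `0` if there are no vertices). -/
noncomputable def localChromaticNumber (G : Tournament V) {n : ℕ} (v : Fin n ≃ V) : ℕ :=
  Finset.univ.sup fun i : Fin n =>
    G.chi {x | ∃ j, x = v j ∧ (G.IsBackwardOutNeighbour v i j ∨ G.IsForwardInNeighbour v i j)}

/-- `G` admits a numbering with local chromatic number at most `l`. -/
def AdmitsNumbering (G : Tournament V) (l : ℕ) : Prop :=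
  ∃ (n : ℕ) (v : Fin n ≃ V), G.localChromaticNumber v ≤ l

end Tournament

namespace Tournament

variable {V : Type u} (G : Tournament V)

/-! Fix `c` and call a tournament bad if it is not `c`-good. The central claim is
`HasBoundedWitnesses c k` for every `k ≥ 1`. It suffices: if a set `S` of bounded size has chromatic
number at least `2 * ⌈c⌉₊`, sort the vertices outside `S` by their adjacency to `S`. There are
boundedly many classes, so one has large chromatic number, and `S` splits into the part complete to
that class and the part complete from it (`isGood_of_finset`).

The claim is proved by induction on `k`. Suppose bad tournaments have bounded witnesses for `k`, and
one of them has none for `k + 1`. Then domination numbers are bounded in it and in its reverse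
(`exists_dominates_card_le`), and it has no heavy clique on `k + 1` vertices
(`exists_lt_chi_of_heavy_clique`). Both hold because a set of chromatic number `k` meets every class
of a cover by `k` acyclic sets, so well-placed witnesses for `k` force a monochromatic triangle.

A second induction, on the size of forbidden heavy cliques, bounds the chromatic number
(`exists_chi_le_of_no_heavy_clique`). Heavy neighbourhoods are controlled by the previous size;
bounded domination then makes each vertex comparable under `Forward` to all but a set of bounded
chromatic number, and a triangle inequality for `gap` excludes short `Forward` cycles. Such a
near-order is close to linear: ordering vertices by their position along a longest chain of bags
gives bounded local chromatic number (`NearOrder.admitsNumbering`), and the hypothesis on such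
numberings applies. -/

theorem adj_asymm {G : Tournament V} {x y : V} (h : G.Adj x y) : ¬ G.Adj y x := by
  have hne : x ≠ y := fun e => G.irrefl y (e ▸ h)
  rcases G.exactly_one x y hne with h' | h'
  · exact h'.2
  · exact fun _ => h'.2 h

theorem adj_or {G : Tournament V} {x y : V} (h : x ≠ y) : G.Adj x y ∨ G.Adj y x := by
  rcases G.exactly_one x y h with h' | h'
  · exact Or.inl h'.1
  · exact Or.inr h'.1

theorem adj_of_not_adj {G : Tournament V} {x y : V} (h : x ≠ y) (h' : ¬ G.Adj y x) : G.Adj x y :=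
  (adj_or h).resolve_right h'

/-! ### Acyclic sets and covers by acyclic sets -/

/-- No directed cycle of `G` has all its vertices in `A`. -/
def AcyclicOn (A : Set V) : Prop :=
  ∀ v, ¬ Relation.TransGen (fun x y => x ∈ A ∧ y ∈ A ∧ G.Adj x y) v v

/-- `A` is covered by `k` acyclic sets. -/
def Colorable (A : Set V) (k : ℕ) : Prop :=
  ∃ B : Fin k → Set V, A ⊆ ⋃ i, B i ∧ ∀ i, G.AcyclicOn (B i)

variable {G}

theorem AcyclicOn.mono {A B : Set V} (hB : G.AcyclicOn B) (h : A ⊆ B) : G.AcyclicOn A :=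
  fun v hv => hB v (hv.lift id fun _ _ hxy => ⟨h hxy.1, h hxy.2.1, hxy.2.2⟩)

theorem AcyclicOn.no_triangle {A : Set V} (hA : G.AcyclicOn A) {x y z : V} (hx : x ∈ A)
    (hy : y ∈ A) (hz : z ∈ A) (hxy : G.Adj x y) (hyz : G.Adj y z) (hzx : G.Adj z x) : False :=
  hA x (((Relation.TransGen.single ⟨hx, hy, hxy⟩).tail ⟨hy, hz, hyz⟩).tail ⟨hz, hx, hzx⟩)

theorem acyclicOn_empty : G.AcyclicOn ∅ := fun v hv => by
  obtain ⟨_, h, _⟩ := Relation.TransGen.head'_iff.1 hv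
  exact h.1

theorem acyclicOn_singleton (a : V) : G.AcyclicOn {a} := fun v hv => by
  obtain ⟨b, ⟨h1, h2, h3⟩, _⟩ := Relation.TransGen.head'_iff.1 hv
  rw [Set.mem_singleton_iff] at h1 h2
  subst h1 h2
  exact G.irrefl _ h3

theorem acyclicOn_induce_iff {X : Set V} {A : Set X} :
    (G.induce X).AcyclicOn A ↔ G.AcyclicOn (Subtype.val '' A) := by
  constructor
  · intro h v hv
    have key : ∀ w, Relation.TransGen
        (fun x y => x ∈ Subtype.val '' A ∧ y ∈ Subtype.val '' A ∧ G.Adj x y) v w →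
        ∃ a b : X, a.1 = v ∧ b.1 = w ∧
          Relation.TransGen (fun x y => x ∈ A ∧ y ∈ A ∧ (G.induce X).Adj x y) a b := by
      intro w hw
      induction hw with
      | single h =>
        obtain ⟨⟨a, ha, rfl⟩, ⟨b, hb, rfl⟩, hab⟩ := h
        exact ⟨a, b, rfl, rfl, .single ⟨ha, hb, hab⟩⟩
      | tail _ h ih =>
        obtain ⟨a, b, rfl, hb, hab⟩ := ih
        obtain ⟨⟨b', hb', rfl⟩, ⟨c, hc, rfl⟩, hbc⟩ := h
        obtain rfl := Subtype.ext hb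
        exact ⟨a, c, rfl, rfl, hab.tail ⟨hb', hc, hbc⟩⟩
    obtain ⟨a, b, ha, hb, hab⟩ := key v hv
    obtain rfl : a = b := Subtype.ext (ha.trans hb.symm)
    exact h a hab
  · intro h v hv
    exact h v.1 (hv.lift Subtype.val fun a b hab =>
      ⟨⟨a, hab.1, rfl⟩, ⟨b, hab.2.1, rfl⟩, hab.2.2⟩)

theorem acyclicOn_univ_iff : G.AcyclicOn Set.univ ↔ G.Acyclic := by
  simp [AcyclicOn, Acyclic]

theorem acyclic_induce_iff {A : Set V} : (G.induce A).Acyclic ↔ G.AcyclicOn A := by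
  rw [← acyclicOn_univ_iff, acyclicOn_induce_iff, Set.image_univ, Subtype.range_coe]

theorem colorable_induce_iff {X : Set V} {A : Set X} {k : ℕ} :
    (G.induce X).Colorable A k ↔ G.Colorable (Subtype.val '' A) k := by
  constructor
  · rintro ⟨B, hB, hB'⟩
    refine ⟨fun i => Subtype.val '' B i, ?_, fun i => acyclicOn_induce_iff.1 (hB' i)⟩
    rw [← Set.image_iUnion]
    exact Set.image_mono hB
  · rintro ⟨B, hB, hB'⟩
    refine ⟨fun i => Subtype.val ⁻¹' B i, ?_, fun i => acyclicOn_induce_iff.2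
      ((hB' i).mono (Set.image_preimage_subset _ _))⟩
    rw [← Set.preimage_iUnion]
    exact Set.image_subset_iff.1 hB

theorem Colorable.mono {A B : Set V} {k : ℕ} (hB : G.Colorable B k) (h : A ⊆ B) :
    G.Colorable A k := by
  obtain ⟨C, hC, hC'⟩ := hB
  exact ⟨C, h.trans hC, hC'⟩

theorem Colorable.union {A B : Set V} {k l : ℕ} (hA : G.Colorable A k) (hB : G.Colorable B l) :
    G.Colorable (A ∪ B) (k + l) := by
  obtain ⟨C, hC, hC'⟩ := hA
  obtain ⟨D, hD, hD'⟩ := hB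
  refine ⟨Fin.append C D, ?_, fun i => ?_⟩
  · rintro x (hx | hx)
    · obtain ⟨i, hi⟩ := Set.mem_iUnion.1 (hC hx)
      exact Set.mem_iUnion.2 ⟨Fin.castAdd l i, by simpa using hi⟩
    · obtain ⟨i, hi⟩ := Set.mem_iUnion.1 (hD hx)
      exact Set.mem_iUnion.2 ⟨Fin.natAdd k i, by simpa using hi⟩
  · refine Fin.addCases (fun i => ?_) (fun i => ?_) i
    · simpa using hC' i
    · simpa using hD' i

theorem colorable_empty (k : ℕ) : G.Colorable ∅ k :=
  ⟨fun _ => ∅, Set.empty_subset _, fun _ => acyclicOn_empty⟩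

theorem Colorable.mono_right {A : Set V} {k l : ℕ} (hA : G.Colorable A k) (h : k ≤ l) :
    G.Colorable A l := by
  obtain ⟨m, rfl⟩ := Nat.exists_eq_add_of_le h
  simpa using hA.union (colorable_empty m)

variable (G) in
/-- Reverse all edges. -/
def reverse : Tournament V where
  Adj v w := G.Adj w v
  irrefl v := G.irrefl v
  exactly_one v w h := G.exactly_one w v h.symm

theorem acyclicOn_reverse_iff {A : Set V} : G.reverse.AcyclicOn A ↔ G.AcyclicOn A := by
  refine forall_congr' fun v => not_congr ?_
  rw [← Relation.transGen_swap]
  have : Function.swap (fun x y => x ∈ A ∧ y ∈ A ∧ G.reverse.Adj x y) =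
      fun x y => x ∈ A ∧ y ∈ A ∧ G.Adj x y := by
    funext x y
    simp only [Function.swap, reverse, eq_iff_iff]
    tauto
  rw [this]

/-! ### Chromatic numbers of vertex sets -/

variable [Finite V]

theorem colorable_card (A : Set V) : G.Colorable A (Nat.card V) :=
  ⟨fun i => {(Finite.equivFin V).symm i}, fun x _ => Set.mem_iUnion.2 ⟨Finite.equivFin V x, by simp⟩,
    fun _ => acyclicOn_singleton _⟩

theorem chromaticNumber_le_iff {k : ℕ} : G.chromaticNumber ≤ k ↔ G.Colorable Set.univ k := by
  have hset : {k : ℕ | ∃ A : Fin k → Set V, (⋃ i, A i) = Set.univ ∧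
      ∀ i, (G.induce (A i)).Acyclic} = {k | G.Colorable Set.univ k} := by
    ext k
    simp only [Set.mem_ofPred_eq, acyclic_induce_iff, Colorable, Set.univ_subset_iff]
  unfold chromaticNumber
  rw [hset]
  constructor
  · intro h
    have := Nat.sInf_mem (s := {k | G.Colorable Set.univ k}) ⟨_, colorable_card Set.univ⟩
    exact Colorable.mono_right this h
  · exact fun h => Nat.sInf_le h

theorem chi_le_iff {A : Set V} {k : ℕ} : G.chi A ≤ k ↔ G.Colorable A k := by
  unfold chi
  rw [chromaticNumber_le_iff, colorable_induce_iff, Set.image_univ, Subtype.range_coe]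

theorem chi_univ : G.chi Set.univ = G.chromaticNumber :=
  eq_of_forall_ge_iff fun _ => chi_le_iff.trans chromaticNumber_le_iff.symm

theorem chi_induce {X : Set V} (A : Set X) : (G.induce X).chi A = G.chi (Subtype.val '' A) :=
  eq_of_forall_ge_iff fun _ => chi_le_iff.trans (colorable_induce_iff.trans chi_le_iff.symm)

theorem chi_mono {A B : Set V} (h : A ⊆ B) : G.chi A ≤ G.chi B :=
  chi_le_iff.2 ((chi_le_iff.1 le_rfl).mono h)

theorem chi_union_le (A B : Set V) : G.chi (A ∪ B) ≤ G.chi A + G.chi B :=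
  chi_le_iff.2 ((chi_le_iff.1 le_rfl).union (chi_le_iff.1 le_rfl))

theorem chi_le_add {A B C : Set V} (h : A ⊆ B ∪ C) : G.chi A ≤ G.chi B + G.chi C :=
  (chi_mono h).trans (chi_union_le _ _)

theorem chi_empty : G.chi ∅ = 0 := Nat.le_zero.1 (chi_le_iff.2 (colorable_empty 0))

theorem chi_singleton_le (a : V) : G.chi {a} ≤ 1 :=
  chi_le_iff.2 ⟨fun _ => {a}, fun _ hx => Set.mem_iUnion.2 ⟨0, hx⟩, fun _ => acyclicOn_singleton a⟩

theorem nonempty_of_chi_pos {A : Set V} (h : 0 < G.chi A) : A.Nonempty := by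
  by_contra hA
  rw [Set.not_nonempty_iff_eq_empty.1 hA, chi_empty] at h
  exact lt_irrefl _ h

theorem chi_biUnion_le {ι : Type*} (D : Finset ι) (f : ι → Set V) (a : ℕ)
    (h : ∀ d ∈ D, G.chi (f d) ≤ a) : G.chi (⋃ d ∈ D, f d) ≤ D.card * a := by
  classical
  induction D using Finset.induction_on with
  | empty => simp [chi_empty]
  | insert d D hd ih =>
    rw [Finset.set_biUnion_insert, Finset.card_insert_of_notMem hd]
    have h1 := h d (Finset.mem_insert_self _ _)
    have h2 := ih fun e he => h e (Finset.mem_insert_of_mem he)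
    have h3 := chi_union_le (G := G) (f d) (⋃ d ∈ D, f d)
    rw [add_mul, one_mul]
    omega

theorem chi_le_of_subset_biUnion {ι : Type*} {X : Set V} (D : Finset ι) (f : ι → Set V) {a C : ℕ}
    (hX : ∀ x ∈ X, ∃ d ∈ D, x ∈ f d) (hC : D.card ≤ C) (h : ∀ d ∈ D, G.chi (f d) ≤ a) :
    G.chi X ≤ C * a :=
  (chi_mono fun x hx => by simpa using hX x hx).trans
    ((chi_biUnion_le D f a h).trans (Nat.mul_le_mul_right _ hC))

theorem chi_finset_le_card (S : Finset V) : G.chi (S : Set V) ≤ S.card := by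
  have := chi_le_of_subset_biUnion (G := G) (X := (S : Set V)) S (fun x => {x})
    (fun x hx => ⟨x, hx, rfl⟩) le_rfl fun d _ => chi_singleton_le d
  omega

/-- If `k` acyclic sets cover a set of chromatic number at least `k`, then each of them meets it. -/
theorem exists_mem_color {k : ℕ} {S : Set V} {B : Fin k → Set V} (hk : k ≤ G.chi S)
    (hS : S ⊆ ⋃ i, B i) (hB : ∀ i, G.AcyclicOn (B i)) (i : Fin k) : ∃ q ∈ S, q ∈ B i := by
  by_contra! hcon
  obtain ⟨m, rfl⟩ : ∃ m, k = m + 1 := ⟨k - 1, by have := i.2; omega⟩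
  have : G.Colorable S m := by
    refine ⟨fun j => B (i.succAbove j), fun x hx => ?_, fun j => hB _⟩
    obtain ⟨j, hj⟩ := Set.mem_iUnion.1 (hS hx)
    have hji : j ≠ i := fun e => hcon x hx (e ▸ hj)
    obtain ⟨j', rfl⟩ := Fin.exists_succAbove_eq hji
    exact Set.mem_iUnion.2 ⟨j', hj⟩
  have := chi_le_iff.2 this
  omega

/-! ### Domination -/

/-- A nonempty acyclic set has a source. -/
theorem AcyclicOn.exists_source {A : Set V} (hA : G.AcyclicOn A) (hne : A.Nonempty) :
    ∃ a ∈ A, ∀ x ∈ A, x = a ∨ G.Adj a x := by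
  let r : V → V → Prop := Relation.TransGen fun x y => x ∈ A ∧ y ∈ A ∧ G.Adj x y
  have : IsTrans V r := ⟨fun _ _ _ h1 h2 => h1.trans h2⟩
  have : Std.Irrefl r := ⟨hA⟩
  have hwf : WellFounded r := Finite.wellFounded_of_trans_of_irrefl r
  obtain ⟨a, ha, hmin⟩ := hwf.has_min A hne
  refine ⟨a, ha, fun x hx => ?_⟩
  by_cases hxa : x = a
  · exact Or.inl hxa
  · exact Or.inr (adj_of_not_adj (Ne.symm hxa) fun h => hmin x hx (.single ⟨hx, ha, h⟩))

variable (G) in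
/-- Every vertex of `T` lies in `D` or is an out-neighbour of a vertex of `D`. -/
def Dominates (D : Finset V) (T : Set V) : Prop :=
  ∀ x ∈ T, x ∈ D ∨ ∃ d ∈ D, G.Adj d x

/-- The sources of the colour classes of an optimal colouring dominate. -/
theorem exists_dominates_card_le_chi (T : Set V) :
    ∃ D : Finset V, (D : Set V) ⊆ T ∧ D.card ≤ G.chi T ∧ G.Dominates D T := by
  classical
  obtain ⟨B, hB, hB'⟩ := chi_le_iff.1 (le_refl (G.chi T))
  have key : ∀ i, ∃ D : Finset V, (D : Set V) ⊆ T ∧ D.card ≤ 1 ∧ G.Dominates D (T ∩ B i) := by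
    intro i
    rcases (T ∩ B i).eq_empty_or_nonempty with h | h
    · exact ⟨∅, by simp, by simp, by simp [h, Dominates]⟩
    · obtain ⟨a, ha, hdom⟩ := ((hB' i).mono Set.inter_subset_right).exists_source h
      refine ⟨{a}, by simpa using ha.1, by simp, fun x hx => ?_⟩
      simpa using hdom x hx
  choose g hgT hg1 hgd using key
  refine ⟨Finset.univ.biUnion g, ?_, ?_, fun x hx => ?_⟩
  · intro x hx
    obtain ⟨i, _, hi⟩ := Finset.mem_biUnion.1 hx
    exact hgT i hi
  · simpa using Finset.card_biUnion_le_card_mul Finset.univ g 1 fun i _ => hg1 i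
  · obtain ⟨i, hi⟩ := Set.mem_iUnion.1 (hB hx)
    rcases hgd i x ⟨hx, hi⟩ with h | ⟨d, hd, h⟩
    · exact Or.inl (Finset.mem_biUnion.2 ⟨i, Finset.mem_univ _, h⟩)
    · exact Or.inr ⟨d, Finset.mem_biUnion.2 ⟨i, Finset.mem_univ _, hd⟩, h⟩

theorem chi_reverse (A : Set V) : G.reverse.chi A = G.chi A :=
  eq_of_forall_ge_iff fun _ => by
    simp only [chi_le_iff, Colorable, acyclicOn_reverse_iff]

/-- If every set of large chromatic number contains a bounded-size set of chromatic number `k`, but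
no bounded-size set has chromatic number `k + 1`, then domination numbers are bounded. -/
theorem exists_dominates_card_le {k t N w : ℕ} (hk : 1 ≤ k) (hw : w = k * (t + N + 1))
    (hP : ∀ X : Set V, t ≤ G.chi X →
      ∃ S : Finset V, (S : Set V) ⊆ X ∧ S.card ≤ N ∧ k ≤ G.chi (S : Set V))
    (hno : ∀ U : Finset V, U.card ≤ N + w + 2 ^ w * N → G.chi (U : Set V) ≤ k) (T : Set V) :
    ∃ D : Finset V, (D : Set V) ⊆ T ∧ D.card ≤ w + t ∧ G.Dominates D T := by
  classical
  have := Fintype.ofFinite V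
  -- `D` is a minimum dominating set; each exchange below that would yield a smaller one forces some
  -- set to have chromatic number at least `t`.
  obtain ⟨D, hD, hDmin⟩ := Finset.exists_min_image
    (Finset.univ.filter fun D : Finset V => (D : Set V) ⊆ T ∧ G.Dominates D T) Finset.card
    ⟨T.toFinset, Finset.mem_filter.2 ⟨Finset.mem_univ _, by simp, fun x hx => Or.inl (by simpa)⟩⟩
  simp only [Finset.mem_filter, Finset.mem_univ, true_and, and_imp] at hD hDmin
  obtain ⟨hDT, hDd⟩ := hD
  by_contra! hcon
  have hDw : w + t < D.card := by
    by_contra! h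
    exact hcon D hDT h hDd
  obtain ⟨W, hWD, hWc⟩ := Finset.exists_subset_card_eq (show w ≤ D.card by omega)
  have hWT : (W : Set V) ⊆ T := fun x hx => hDT (hWD hx)
  -- Otherwise `W` and fewer than `t` further vertices would dominate `T`.
  have hA : ∃ A : Finset V, (A : Set V) ⊆ {x | x ∈ T ∧ x ∉ W ∧ ∀ y ∈ W, ¬ G.Adj y x} ∧
      A.card ≤ N ∧ k ≤ G.chi (A : Set V) := by
    apply hP
    by_contra! hlt
    obtain ⟨D₁, hD₁, hc, hd⟩ := exists_dominates_card_le_chi (G := G)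
      {x | x ∈ T ∧ x ∉ W ∧ ∀ y ∈ W, ¬ G.Adj y x}
    have h1 : D.card ≤ (W ∪ D₁).card := by
      apply hDmin
      · rw [Finset.coe_union]
        exact Set.union_subset hWT fun x hx => (hD₁ hx).1
      · intro x hx
        by_cases hxW : x ∈ W
        · exact Or.inl (Finset.mem_union_left _ hxW)
        by_cases hxy : ∃ y ∈ W, G.Adj y x
        · obtain ⟨y, hy, hyx⟩ := hxy
          exact Or.inr ⟨y, Finset.mem_union_left _ hy, hyx⟩
        push Not at hxy
        rcases hd x ⟨hx, hxW, hxy⟩ with h | ⟨y, hy, h⟩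
        · exact Or.inl (Finset.mem_union_right _ h)
        · exact Or.inr ⟨y, Finset.mem_union_right _ hy, h⟩
    have h2 := Finset.card_union_le W D₁
    omega
  obtain ⟨A, hAT, hAN, hAk⟩ := hA
  have hAW : ∀ a ∈ A, ∀ y ∈ W, G.Adj a y := fun a ha y hy =>
    adj_of_not_adj (fun e => (hAT ha).2.1 (e ▸ hy)) ((hAT ha).2.2 y hy)
  obtain ⟨a₀, ha₀⟩ : (A : Set V).Nonempty := nonempty_of_chi_pos (G := G) (by omega)
  -- Otherwise `S`, of size `t + N + 1`, could be exchanged for `A` and fewer than `t` further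
  -- vertices. The removed vertices of `S` stay dominated, since `A` is nonempty and complete to
  -- `W`.
  have hS : ∀ S : Finset V, ∃ Q : Finset V, Q.card ≤ N ∧ (S ⊆ W → S.card = t + N + 1 →
      (Q : Set V) ⊆ {q | q ∈ T ∧ (∃ s ∈ S, G.Adj s q) ∧ q ∉ A ∧ ∀ a ∈ A, ¬ G.Adj a q} ∧
      k ≤ G.chi (Q : Set V)) := by
    intro S
    by_cases hSW : S ⊆ W ∧ S.card = t + N + 1
    swap
    · exact ⟨∅, by simp, fun h1 h2 => absurd ⟨h1, h2⟩ hSW⟩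
    obtain ⟨hSW, hSc⟩ := hSW
    obtain ⟨Q, h1, h2, h3⟩ := hP
      {q | q ∈ T ∧ (∃ s ∈ S, G.Adj s q) ∧ q ∉ A ∧ ∀ a ∈ A, ¬ G.Adj a q} (by
        by_contra! hlt
        obtain ⟨D₂, hD₂, hc, hd⟩ := exists_dominates_card_le_chi (G := G)
          {q | q ∈ T ∧ (∃ s ∈ S, G.Adj s q) ∧ q ∉ A ∧ ∀ a ∈ A, ¬ G.Adj a q}
        have h1 : D.card ≤ ((D \ S) ∪ (A ∪ D₂)).card := by
          apply hDmin
          · intro x hx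
            simp only [Finset.coe_union, Set.mem_union, Finset.mem_coe, Finset.mem_sdiff] at hx
            rcases hx with hx | hx | hx
            · exact hDT hx.1
            · exact (hAT hx).1
            · exact (hD₂ hx).1
          · intro x hx
            by_cases hxA : x ∈ A
            · exact Or.inl (by simp [hxA])
            by_cases hxa : ∃ a ∈ A, G.Adj a x
            · obtain ⟨a, ha, hax⟩ := hxa
              exact Or.inr ⟨a, by simp [ha], hax⟩
            have hxS : x ∉ S := fun h => hxa ⟨a₀, ha₀, hAW a₀ ha₀ x (hSW h)⟩
            rcases hDd x hx with h | ⟨d, hd', h⟩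
            · exact Or.inl (by simp [h, hxS])
            by_cases hdS : d ∈ S
            · push Not at hxa
              rcases hd x ⟨hx, ⟨d, hdS, h⟩, hxA, hxa⟩ with h | ⟨y, hy, h⟩
              · exact Or.inl (by simp [h])
              · exact Or.inr ⟨y, by simp [hy], h⟩
            · exact Or.inr ⟨d, by simp [hd', hdS], h⟩
        have h2 := Finset.card_union_le (D \ S) (A ∪ D₂)
        have h3 := Finset.card_union_le A D₂
        have h4 := Finset.card_sdiff_of_subset (hSW.trans hWD)
        have h5 := Finset.card_le_card (hSW.trans hWD)
        omega)
    exact ⟨Q, h2, fun _ _ => ⟨h1, h3⟩⟩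
  choose Q hQN hQ using hS
  have hU : G.chi ((A ∪ W ∪ W.powerset.biUnion Q : Finset V) : Set V) ≤ k := by
    apply hno
    have h1 := Finset.card_union_le (A ∪ W) (W.powerset.biUnion Q)
    have h2 := Finset.card_union_le A W
    have h3 := Finset.card_biUnion_le_card_mul W.powerset Q N fun S _ => hQN S
    rw [Finset.card_powerset, hWc] at h3
    omega
  obtain ⟨B, hB, hB'⟩ := chi_le_iff.1 hU
  have hcol : ∀ x ∈ A ∪ W ∪ W.powerset.biUnion Q, ∃ i, x ∈ B i := fun x hx =>
    Set.mem_iUnion.1 (hB hx)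
  have hcolW : ∀ x : V, ∃ i : Fin k, x ∈ W → x ∈ B i := by
    intro x
    by_cases hx : x ∈ W
    · obtain ⟨i, hi⟩ := hcol x (by simp [hx])
      exact ⟨i, fun _ => hi⟩
    · exact ⟨⟨0, hk⟩, fun h => absurd h hx⟩
  choose f hf using hcolW
  -- The choice of `w` gives some colour at least `t + N + 1` times on `W`. With `S` taken in that
  -- colour, `A` and `Q S` supply the other two vertices of a monochromatic triangle `a → s → q →
  -- a`.
  obtain ⟨i, -, hi⟩ := Finset.exists_le_card_fiber_of_mul_le_card_of_maps_to
    (s := W) (t := (Finset.univ : Finset (Fin k))) (f := f) (n := t + N + 1)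
    (fun _ _ => Finset.mem_univ _) ⟨⟨0, hk⟩, Finset.mem_univ _⟩ (by simp [hWc, hw])
  obtain ⟨S, hSf, hSc⟩ := Finset.exists_subset_card_eq hi
  have hSW : S ⊆ W := fun x hx => (Finset.mem_filter.1 (hSf hx)).1
  obtain ⟨hQS, hQk⟩ := hQ S hSW hSc
  obtain ⟨a, ha, hai⟩ := exists_mem_color hAk
    (fun x hx => hB (by simp only [Finset.mem_coe] at hx; simp [hx])) hB' i
  obtain ⟨q, hq, hqi⟩ := exists_mem_color hQk
    (fun x hx => hB (by
      simp only [Finset.coe_union, Finset.coe_biUnion, Set.mem_union, Set.mem_iUnion]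
      exact Or.inr ⟨S, by simpa using hSW, hx⟩)) hB' i
  obtain ⟨-, ⟨s, hs, hsq⟩, hqA, hqa⟩ := hQS hq
  have hsi : s ∈ B i := by
    have := (Finset.mem_filter.1 (hSf hs)).2
    exact this ▸ hf s (hSW hs)
  exact (hB' i).no_triangle hai hsi hqi (hAW a ha s (hSW hs)) hsq
    (adj_of_not_adj (fun e => hqA (e ▸ ha)) (hqa a ha))

end Tournament
namespace Tournament

variable {V : Type u} [Finite V] {G : Tournament V}

/-! ### Splitting sets under bounded domination -/

section Splitting

variable {C : ℕ}
  (hdom : ∀ T : Set V, ∃ D : Finset V, (D : Set V) ⊆ T ∧ D.card ≤ C ∧ G.Dominates D T)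

include hdom

/-- Vertices with few out-neighbours outside `Y` (in chromatic number) form a set of bounded
chromatic number. -/
theorem chi_le_of_chi_out_le {T X Y : Set V} {a : ℕ} (hTX : T ⊆ X)
    (hT : ∀ y ∈ T, G.chi {z | z ∈ X ∧ G.Adj y z ∧ z ∉ Y} ≤ a) (hTY : ∀ y ∈ T, y ∉ Y) :
    G.chi T ≤ C * (a + 1) := by
  obtain ⟨D, hDT, hDC, hD⟩ := hdom T
  refine chi_le_of_subset_biUnion D (fun y => {z | z ∈ X ∧ G.Adj y z ∧ z ∉ Y} ∪ {y})
    (fun x hx => ?_) hDC fun d hd => (chi_union_le _ _).trans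
      (Nat.add_le_add (hT d (hDT hd)) (chi_singleton_le d))
  rcases hD x hx with h | ⟨d, hd, h⟩
  · exact ⟨x, h, Or.inr rfl⟩
  · exact ⟨d, hd, Or.inl ⟨hTX hx, h, hTY x hx⟩⟩

end Splitting

/-- A set of large chromatic number has a vertex splitting it into two sets of large chromatic
number. -/
theorem exists_split {C a : ℕ} {L : Set V}
    (hdom : ∀ T : Set V, ∃ D : Finset V, (D : Set V) ⊆ T ∧ D.card ≤ C ∧ G.Dominates D T)
    (hdom' : ∀ T : Set V, ∃ D : Finset V, (D : Set V) ⊆ T ∧ D.card ≤ C ∧ G.reverse.Dominates D T)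
    (hL : 2 * (C * (a + 1)) < G.chi L) :
    ∃ x ∈ L, a < G.chi {z | z ∈ L ∧ G.Adj x z} ∧ a < G.chi {z | z ∈ L ∧ G.Adj z x} := by
  by_contra! hcon
  have h1 : G.chi {x | x ∈ L ∧ G.chi {z | z ∈ L ∧ G.Adj x z} ≤ a} ≤ C * (a + 1) :=
    chi_le_of_chi_out_le hdom (X := L) (Y := ∅) (fun x hx => hx.1)
      (fun y hy => by simpa using hy.2) (by simp)
  have h2 : G.reverse.chi {x | x ∈ L ∧ G.chi {z | z ∈ L ∧ G.Adj z x} ≤ a} ≤ C * (a + 1) :=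
    chi_le_of_chi_out_le hdom' (X := L) (Y := ∅) (fun x hx => hx.1)
      (fun y hy => by
        rw [chi_reverse]
        refine le_trans (chi_mono ?_) hy.2
        exact fun z hz => ⟨hz.1, hz.2.1⟩) (by simp)
  rw [chi_reverse] at h2
  have h3 : G.chi L ≤ G.chi {x | x ∈ L ∧ G.chi {z | z ∈ L ∧ G.Adj x z} ≤ a} +
      G.chi {x | x ∈ L ∧ G.chi {z | z ∈ L ∧ G.Adj z x} ≤ a} :=
    chi_le_add fun x hx => by
      by_cases h : G.chi {z | z ∈ L ∧ G.Adj x z} ≤ a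
      · exact Or.inl ⟨hx, h⟩
      · exact Or.inr ⟨hx, hcon x hx (by omega)⟩
  omega

/-! ### Near-orders and chains of bags -/

variable (G) in
/-- A list of subsets of `X`, each of chromatic number more than `b`, such that no `D`-arc goes from
a later set to an earlier one. -/
def IsBagChain (D : V → V → Prop) (X : Set V) (b : ℕ) (l : List (Set V)) : Prop :=
  (∀ B ∈ l, B ⊆ X ∧ b < G.chi B) ∧ l.Pairwise fun B B' => ∀ x ∈ B, ∀ y ∈ B', ¬ D y x

variable (G) in
/-- A subrelation `D` of adjacency on `X` without directed cycles of length at most five, in which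
every vertex is comparable to all vertices outside a set of chromatic number at most `s`. -/
structure NearOrder (D : V → V → Prop) (X : Set V) (s : ℕ) : Prop where
  adj : ∀ x y, D x y → G.Adj x y
  no_three : ∀ x y z, D x y → D y z → D z x → False
  no_four : ∀ x y z w, D x y → D y z → D z w → D w x → False
  no_five : ∀ x y z w v, D x y → D y z → D z w → D w v → D v x → False
  chi_incomparable : ∀ x ∈ X, G.chi {y | y ∈ X ∧ ¬ D x y ∧ ¬ D y x} ≤ s

namespace NearOrder

variable {D : V → V → Prop} {X : Set V} {s : ℕ}

/-- A set of large chromatic number contains a vertex avoiding incomparability with two given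
vertices. -/
theorem exists_comparable (hD : G.NearOrder D X s) {x y : V} (hx : x ∈ X) (hy : y ∈ X)
    {B : Set V} (hBX : B ⊆ X) (hB : 2 * s < G.chi B) :
    ∃ z ∈ B, (D x z ∨ D z x) ∧ (D y z ∨ D z y) := by
  by_contra! hcon
  have h1 : G.chi B ≤ G.chi {z | z ∈ X ∧ ¬ D x z ∧ ¬ D z x} +
      G.chi {z | z ∈ X ∧ ¬ D y z ∧ ¬ D z y} := chi_le_add fun z hz => by
    by_cases h : D x z ∨ D z x
    · exact Or.inr ⟨hBX hz, hcon z hz h⟩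
    · exact Or.inl ⟨hBX hz, not_or.1 h⟩
  have h2 := hD.chi_incomparable x hx
  have h3 := hD.chi_incomparable y hy
  omega

section Split

variable {C : ℕ} (hD : G.NearOrder D X s)
  (hdom : ∀ T : Set V, ∃ D : Finset V, (D : Set V) ⊆ T ∧ D.card ≤ C ∧ G.Dominates D T)
  (hdom' : ∀ T : Set V, ∃ D : Finset V, (D : Set V) ⊆ T ∧ D.card ≤ C ∧ G.reverse.Dominates D T)

include hD hdom hdom'

theorem exists_split {a : ℕ} {L : Set V} (hLX : L ⊆ X) (hL : 2 * (C * (a + s + 1)) < G.chi L) :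
    ∃ B₁ B₂ : Set V, B₁ ⊆ L ∧ B₂ ⊆ L ∧ a < G.chi B₁ ∧ a < G.chi B₂ ∧
      ∀ x ∈ B₁, ∀ y ∈ B₂, ¬ D y x := by
  obtain ⟨x, hxL, h1, h2⟩ := Tournament.exists_split hdom hdom' hL
  have hs := hD.chi_incomparable x (hLX hxL)
  refine ⟨{z | z ∈ L ∧ D z x}, {z | z ∈ L ∧ D x z}, fun z hz => hz.1, fun z hz => hz.1, ?_, ?_,
    fun y hy z hz h => hD.no_three _ _ _ hy.2 hz.2 h⟩
  · have : G.chi {z | z ∈ L ∧ G.Adj z x} ≤ G.chi {z | z ∈ L ∧ D z x} +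
        G.chi {y | y ∈ X ∧ ¬ D x y ∧ ¬ D y x} := chi_le_add fun z hz => by
      by_cases h : D z x
      · exact Or.inl ⟨hz.1, h⟩
      · exact Or.inr ⟨hLX hz.1, fun h' => adj_asymm hz.2 (hD.adj _ _ h'), h⟩
    omega
  · have : G.chi {z | z ∈ L ∧ G.Adj x z} ≤ G.chi {z | z ∈ L ∧ D x z} +
        G.chi {y | y ∈ X ∧ ¬ D x y ∧ ¬ D y x} := chi_le_add fun z hz => by
      by_cases h : D x z
      · exact Or.inl ⟨hz.1, h⟩
      · exact Or.inr ⟨hLX hz.1, h, fun h' => adj_asymm hz.2 (hD.adj _ _ h')⟩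
    omega

/-- Split twice: the inner `2 * (C * (2 * s + s + 1))` is what the second split consumes, and the
added `2 * s` keeps the first bag large as well. -/
theorem exists_bagChain_three {L : Set V} (hLX : L ⊆ X)
    (hL : 2 * (C * ((2 * s + 2 * (C * (2 * s + s + 1))) + s + 1)) < G.chi L) :
    ∃ l : List (Set V), l.length = 3 ∧ G.IsBagChain D L (2 * s) l := by
  obtain ⟨B₁, B', h1, h', hc1, hc', hno⟩ := hD.exists_split hdom hdom' hLX hL
  obtain ⟨B₂, B₃, h2, h3, hc2, hc3, hno'⟩ :=
    hD.exists_split hdom hdom' (h'.trans hLX) (show 2 * (C * (2 * s + s + 1)) < _ by omega)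
  refine ⟨[B₁, B₂, B₃], rfl, ?_, ?_⟩
  · simp only [List.mem_cons, List.not_mem_nil, or_false]
    rintro B (rfl | rfl | rfl)
    · exact ⟨h1, by omega⟩
    · exact ⟨h2.trans h', hc2⟩
    · exact ⟨h3.trans h', hc3⟩
  · simp only [List.pairwise_cons, List.mem_cons, List.not_mem_nil, or_false, forall_eq_or_imp,
      forall_eq, List.Pairwise.nil, false_imp_iff, implies_true, and_true]
    exact ⟨⟨fun x hx y hy => hno x hx y (h2 hy), fun x hx y hy => hno x hx y (h3 hy)⟩, hno'⟩

end Split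

section Chain

variable {l : List (Set V)} (hD : G.NearOrder D X s) (hl : G.IsBagChain D X (2 * s) l)

omit [Finite V] in
include hl in
theorem bag_not_back {i j : ℕ} (hij : i < j) (hj : j < l.length) {x y : V} (hx : x ∈ l.getD i ∅)
    (hy : y ∈ l.getD j ∅) : ¬ D y x := by
  rw [List.getD_eq_getElem _ _ (hij.trans hj)] at hx
  rw [List.getD_eq_getElem _ _ hj] at hy
  exact List.pairwise_iff_getElem.1 hl.2 i j _ _ hij x hx y hy

omit [Finite V] in
include hl in
theorem bag_subset_chi {i : ℕ} (hi : i < l.length) :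
    l.getD i ∅ ⊆ X ∧ 2 * s < G.chi (l.getD i ∅) := by
  rw [List.getD_eq_getElem _ _ hi]
  exact hl.1 _ (List.getElem_mem hi)

include hD hl

/-- The bag after the first one is too large to miss a vertex comparable to both ends, and the
absence of backward arcs orients both comparisons. -/
theorem exists_between {i j : ℕ} (hij : i + 2 ≤ j) (hj : j < l.length) {x y : V}
    (hx : x ∈ l.getD i ∅) (hy : y ∈ l.getD j ∅) : ∃ z, D x z ∧ D z y := by
  have hB := bag_subset_chi hl (show i + 1 < l.length by omega)
  obtain ⟨z, hz, h1, h2⟩ := hD.exists_comparable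
    ((bag_subset_chi hl (show i < l.length by omega)).1 hx) ((bag_subset_chi hl hj).1 hy) hB.1 hB.2
  exact ⟨z, h1.resolve_right (bag_not_back hl (Nat.lt_succ_self i) (by omega) hx hz),
    h2.resolve_left (bag_not_back hl (by omega) hj hz hy)⟩

/-- Representatives of alternate bags are distinct by `exists_between`. This bound serves only to
make a longest chain exist. -/
theorem length_le : l.length ≤ 2 * Nat.card V + 1 := by
  by_contra! hcon
  have hne : ∀ i : Fin (Nat.card V + 1), ∃ x, x ∈ l.getD (2 * i.1) ∅ := fun i =>
    nonempty_of_chi_pos (G := G)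
      (lt_of_le_of_lt (Nat.zero_le _) (bag_subset_chi hl (by have := i.2; omega)).2)
  choose g hg using hne
  have hlt : ∀ i j : Fin (Nat.card V + 1), i < j → g i ≠ g j := by
    intro i j hij he
    have hij' : i.1 < j.1 := hij
    obtain ⟨z, h1, h2⟩ := hD.exists_between hl (show 2 * i.1 + 2 ≤ 2 * j.1 by omega)
      (by have := j.2; omega) (hg i) (hg j)
    rw [he] at h1
    exact adj_asymm (hD.adj _ _ h1) (hD.adj _ _ h2)
  have hinj : Function.Injective g := by
    intro i j he
    rcases lt_trichotomy i j with h | h | h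
    · exact absurd he (hlt i j h)
    · exact h
    · exact absurd he.symm (hlt j i h)
  have := Nat.card_le_card_of_injective g hinj
  rw [Nat.card_fin] at this
  omega

theorem no_detour {i j : ℕ} (hij : i + 2 ≤ j) (hj : j < l.length) {v x y : V}
    (hx : x ∈ l.getD i ∅) (hy : y ∈ l.getD j ∅) (hvx : D v x) (hyv : D y v) : False := by
  obtain ⟨z, h1, h2⟩ := hD.exists_between hl hij hj hx hy
  exact hD.no_four _ _ _ _ hvx h1 h2 hyv

end Chain

open Classical in
/-- The position of a vertex with respect to a list of bags: one more than the index of the last bag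
containing an in-neighbour, and `0` if there is none. -/
noncomputable def position (D : V → V → Prop) (l : List (Set V)) (v : V) : ℕ :=
  ((Finset.range l.length).filter fun i => ∃ w ∈ l.getD i ∅, D w v).sup (· + 1)

omit [Finite V] in
theorem lt_position {l : List (Set V)} {v w : V} {i : ℕ} (hi : i < l.length)
    (hw : w ∈ l.getD i ∅) (hwv : D w v) : i < position D l v := by
  classical
  have hmem : i ∈ (Finset.range l.length).filter fun i => ∃ w ∈ l.getD i ∅, D w v :=
    Finset.mem_filter.2 ⟨Finset.mem_range.2 hi, w, hw, hwv⟩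
  unfold position
  refine Nat.lt_of_succ_le ?_
  convert Finset.le_sup (f := (· + 1)) hmem

omit [Finite V] in
theorem exists_of_position_pos {l : List (Set V)} {v : V} (h : 0 < position D l v) :
    ∃ i, position D l v = i + 1 ∧ i < l.length ∧ ∃ w ∈ l.getD i ∅, D w v := by
  classical
  unfold position at h ⊢
  have hne : ((Finset.range l.length).filter fun i => ∃ w ∈ l.getD i ∅, D w v).Nonempty := by
    by_contra hne
    rw [Finset.not_nonempty_iff_eq_empty] at hne
    rw [hne, Finset.sup_empty] at h
    exact lt_irrefl _ h
  obtain ⟨i, hi, he⟩ := Finset.exists_mem_eq_sup _ hne (· + 1)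
  rw [Finset.mem_filter, Finset.mem_range] at hi
  exact ⟨i, he, hi⟩

/-- If `v` lay three positions beyond `u`, the bag at index `position D l u` would contain an
out-neighbour of `u`, and an in-neighbour of `v` would lie at least two bags later. Joining these by
`exists_between` closes a 5-cycle through the arc from `v` to `u`. -/
theorem not_position_lt (hD : G.NearOrder D X s) {l : List (Set V)}
    (hl : G.IsBagChain D X (2 * s) l) {u v : V} (hu : u ∈ X) (hvu : D v u) :
    ¬ position D l u + 3 ≤ position D l v := by
  intro h
  obtain ⟨j, hj, hjl, w, hw, hwv⟩ := exists_of_position_pos (D := D) (l := l) (v := v) (by omega)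
  have hB := bag_subset_chi hl (show position D l u < l.length by omega)
  obtain ⟨z, hz, hzu, -⟩ := hD.exists_comparable hu hu hB.1 hB.2
  have huz : D u z := hzu.resolve_right fun h' =>
    lt_irrefl _ (lt_position (by omega) hz h')
  obtain ⟨y, h1, h2⟩ := hD.exists_between hl (by omega) hjl hz hw
  exact hD.no_five _ _ _ _ _ hvu huz h1 h2 hwv

/-- A fibre of larger chromatic number contains three consecutive bags. They can replace the at most
two bags at indices `j - 2` and `j - 1`, contradicting maximality: `no_detour` rules out arcs back
to earlier bags, and the definition of `position` rules out arcs from later ones. -/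
theorem chi_position_le {C : ℕ} (hD : G.NearOrder D X s)
    (hdom : ∀ T : Set V, ∃ D : Finset V, (D : Set V) ⊆ T ∧ D.card ≤ C ∧ G.Dominates D T)
    (hdom' : ∀ T : Set V, ∃ D : Finset V, (D : Set V) ⊆ T ∧ D.card ≤ C ∧ G.reverse.Dominates D T)
    {l : List (Set V)} (hl : G.IsBagChain D X (2 * s) l)
    (hmax : ∀ l', G.IsBagChain D X (2 * s) l' → l'.length ≤ l.length) (j : ℕ) :
    G.chi {v | v ∈ X ∧ position D l v = j} ≤
      2 * (C * ((2 * s + 2 * (C * (2 * s + s + 1))) + s + 1)) := by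
  by_contra! hcon
  obtain ⟨m, hm3, hm, hmp⟩ := hD.exists_bagChain_three hdom hdom' (fun v hv => hv.1) hcon
  have hjl : j ≤ l.length := by
    obtain ⟨v, hv, hvj⟩ := nonempty_of_chi_pos (lt_of_le_of_lt (Nat.zero_le _) hcon)
    rcases Nat.eq_zero_or_pos j with h | h
    · omega
    · obtain ⟨i, hi, hil, -⟩ := exists_of_position_pos (D := D) (l := l) (v := v) (by omega)
      omega
  have hfirst : ∀ B ∈ l.take (j - 2), ∀ x ∈ B, ∀ y, position D l y = j → ¬ D y x := by
    intro B hB x hx y hy hyx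
    obtain ⟨i, hi, rfl⟩ := List.mem_take_iff_getElem.1 hB
    obtain ⟨j', hj, hjl, w, hw, hwv⟩ := exists_of_position_pos (D := D) (l := l) (v := y) (by omega)
    refine hD.no_detour hl (i := i) (j := j') (by omega) hjl ?_ hw hyx hwv
    rwa [List.getD_eq_getElem _ _ (by omega)]
  have hlast : ∀ B ∈ l.drop j, ∀ x ∈ B, ∀ y, position D l y = j → ¬ D x y := by
    intro B hB x hx y hy hxy
    obtain ⟨i, hi, rfl⟩ := List.mem_drop_iff_getElem.1 hB
    have := lt_position (D := D) (l := l) (i := j + i) (w := x) (v := y) (by omega)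
      (by rwa [List.getD_eq_getElem _ _ (by omega)]) hxy
    omega
  have hnew : G.IsBagChain D X (2 * s) (l.take (j - 2) ++ (m ++ l.drop j)) := by
    refine ⟨fun B hB => ?_, ?_⟩
    · rcases List.mem_append.1 hB with h | h
      · exact hl.1 B (List.mem_of_mem_take h)
      · rcases List.mem_append.1 h with h | h
        · exact ⟨(hm B h).1.trans fun v hv => hv.1, (hm B h).2⟩
        · exact hl.1 B (List.mem_of_mem_drop h)
    · refine List.pairwise_append.2 ⟨hl.2.sublist (List.take_sublist _ _), List.pairwise_append.2
        ⟨hmp, hl.2.sublist (List.drop_sublist _ _), ?_⟩, ?_⟩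
      · intro B hB B' hB' x hx y hy
        exact hlast B' hB' y hy x ((hm B hB).1 hx).2
      · intro B hB B' hB' x hx y hy
        rcases List.mem_append.1 hB' with h | h
        · exact hfirst B hB x hx y ((hm B' h).1 hy).2
        · obtain ⟨i, hi, rfl⟩ := List.mem_take_iff_getElem.1 hB
          obtain ⟨i', hi', rfl⟩ := List.mem_drop_iff_getElem.1 h
          exact List.pairwise_iff_getElem.1 hl.2 i (j + i') (by omega) _ (by omega) x hx y hy
  have := hmax _ hnew
  simp only [List.length_append, List.length_take, List.length_drop] at this
  omega

/-- A near-order gives a numbering of bounded local chromatic number. -/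
theorem admitsNumbering {C : ℕ} (hD : G.NearOrder D X s)
    (hdom : ∀ T : Set V, ∃ D : Finset V, (D : Set V) ⊆ T ∧ D.card ≤ C ∧ G.Dominates D T)
    (hdom' : ∀ T : Set V, ∃ D : Finset V, (D : Set V) ⊆ T ∧ D.card ≤ C ∧
      G.reverse.Dominates D T) :
    (G.induce X).AdmitsNumbering
      (s + 5 * (2 * (C * ((2 * s + 2 * (C * (2 * s + s + 1))) + s + 1)))) := by
  obtain ⟨l, hl, hmax⟩ : ∃ l, G.IsBagChain D X (2 * s) l ∧
      ∀ l', G.IsBagChain D X (2 * s) l' → l'.length ≤ l.length := by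
    have hbdd : BddAbove {n | ∃ l, G.IsBagChain D X (2 * s) l ∧ l.length = n} :=
      ⟨2 * Nat.card V + 1, by rintro n ⟨l, hl, rfl⟩; exact hD.length_le hl⟩
    have hnil : G.IsBagChain D X (2 * s) [] := ⟨by simp, List.Pairwise.nil⟩
    obtain ⟨l, hl, he⟩ := Nat.sSup_mem
      (s := {n | ∃ l, G.IsBagChain D X (2 * s) l ∧ l.length = n}) ⟨0, [], hnil, rfl⟩ hbdd
    refine ⟨l, hl, fun l' hl' => ?_⟩
    rw [he]
    exact le_csSup hbdd ⟨l', hl', rfl⟩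
  set p : V → ℕ := position D l with hp
  let e := (Finite.equivFin X).symm
  let σ := Tuple.sort fun i => p (e i)
  -- In this order a comparable pair joined by a backward edge has positions differing by at most 2,
  -- leaving five fibres besides the incomparable vertices.
  have hmono : ∀ i j, i ≤ j → p (e (σ i)) ≤ p (e (σ j)) := fun i j hij =>
    Tuple.monotone_sort (fun i => p (e i)) hij
  refine ⟨_, σ.trans e, Finset.sup_le fun i _ => ?_⟩
  rw [chi_induce]
  set x : X := e (σ i) with hx
  have hsub : Subtype.val '' {y : X | ∃ j, y = (σ.trans e) j ∧
      ((G.induce X).IsBackwardOutNeighbour (σ.trans e) i j ∨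
        (G.induce X).IsForwardInNeighbour (σ.trans e) i j)} ⊆
      {y | y ∈ X ∧ ¬ D x y ∧ ¬ D y x} ∪
        ⋃ k ∈ Finset.range 5, {v | v ∈ X ∧ position D l v = p x + k - 2} := by
    rintro _ ⟨y, ⟨j, hyj, h⟩, rfl⟩
    have hyj' : e (σ j) = y := hyj.symm
    by_cases hc : ¬ D x y ∧ ¬ D y x
    · exact Or.inl ⟨y.2, hc⟩
    right
    have key : p y ≤ p x + 2 ∧ p x ≤ p y + 2 := by
      rcases h with ⟨hlt, hadj⟩ | ⟨hlt, hadj⟩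
      · have hadj' : G.Adj x y := by
          have : G.Adj (e (σ i)) (e (σ j)) := hadj
          rwa [hyj'] at this
        have h1 := hmono _ _ hlt.le
        rw [hyj'] at h1
        have hxy : D x y := by
          by_contra hxy
          exact hc ⟨hxy, fun h => adj_asymm hadj' (hD.adj _ _ h)⟩
        have h2 := hD.not_position_lt hl y.2 hxy
        change p y ≤ p x at h1
        simp only [← hp] at h2
        omega
      · have hadj' : G.Adj y x := by
          have : G.Adj (e (σ j)) (e (σ i)) := hadj
          rwa [hyj'] at this
        have h1 := hmono _ _ hlt.le
        rw [hyj'] at h1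
        have hxy : D y x := by
          by_contra hxy
          exact hc ⟨fun h => adj_asymm hadj' (hD.adj _ _ h), hxy⟩
        have h2 := hD.not_position_lt hl x.2 hxy
        change p x ≤ p y at h1
        simp only [← hp] at h2
        omega
    simp only [Set.mem_iUnion, Finset.mem_range]
    -- The index 2 stands for the position of `x` itself; truncated subtraction can only repeat the
    -- fibre at 0.
    exact ⟨p y + 2 - p x, by omega, y.2, by simp only [← hp]; omega⟩
  refine (chi_le_add hsub).trans (Nat.add_le_add (hD.chi_incomparable _ x.2) ?_)
  have := chi_biUnion_le (G := G) (Finset.range 5)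
    (fun k => {v | v ∈ X ∧ position D l v = p x + k - 2}) _
    fun k _ => hD.chi_position_le hdom hdom' hl hmax (p x + k - 2)
  rwa [Finset.card_range] at this

end NearOrder

end Tournament
namespace Tournament

/-! ### Heavy and forward edges -/

section Gap

variable {V : Type u} (G : Tournament V)

/-- The chromatic number of the set of out-neighbours of `y` that are not out-neighbours of `x`. -/
noncomputable def gap (x y : V) : ℕ := G.chi {z | G.Adj y z ∧ ¬ G.Adj x z}

/-- An edge lying in triangles whose third vertices have chromatic number more than `t`. -/
def Heavy (t : ℕ) (x y : V) : Prop := G.Adj x y ∧ t < G.gap x y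

/-- An edge that is not heavy, and whose reversed gap is much larger. -/
def Forward (t : ℕ) (x y : V) : Prop := G.Adj x y ∧ G.gap x y ≤ t ∧ 4 * t < G.gap y x

variable {G} [Finite V]

theorem gap_triangle (x y z : V) : G.gap x z ≤ G.gap x y + G.gap y z :=
  chi_le_add fun w hw => by
    by_cases h : G.Adj y w
    · exact Or.inl ⟨h, hw.2⟩
    · exact Or.inr ⟨hw.1, h⟩

/-- By `gap_triangle`, a path of at most four forward edges has gap at most `4 * t` between its
ends, whereas a closing forward edge would need more; hence the factor 4 in `Forward`. A vertex
incomparable to `x` is `x`, a heavy neighbour, or joined to `x` by an edge whose reversed gap is at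
most `4 * t`; domination bounds the last kind. -/
theorem nearOrder_forward {C t s : ℕ} {X : Set V}
    (hdom : ∀ T : Set V, ∃ D : Finset V, (D : Set V) ⊆ T ∧ D.card ≤ C ∧ G.Dominates D T)
    (hdom' : ∀ T : Set V, ∃ D : Finset V, (D : Set V) ⊆ T ∧ D.card ≤ C ∧ G.reverse.Dominates D T)
    (hheavy : ∀ x ∈ X, G.chi {y | y ∈ X ∧ (G.Heavy t x y ∨ G.Heavy t y x)} ≤ s) :
    G.NearOrder (G.Forward t) X (1 + s + (C * (4 * t + 1) + C * (4 * t + 1))) where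
  adj _ _ h := h.1
  no_three x y z h1 h2 h3 := by
    have := gap_triangle (G := G) x y z
    have := h1.2.1
    have := h2.2.1
    have := h3.2.2
    omega
  no_four x y z w h1 h2 h3 h4 := by
    have := gap_triangle (G := G) x y w
    have := gap_triangle (G := G) y z w
    have := h1.2.1
    have := h2.2.1
    have := h3.2.1
    have := h4.2.2
    omega
  no_five x y z w v h1 h2 h3 h4 h5 := by
    have := gap_triangle (G := G) x y v
    have := gap_triangle (G := G) y z v
    have := gap_triangle (G := G) z w v
    have := h1.2.1
    have := h2.2.1
    have := h3.2.1
    have := h4.2.1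
    have := h5.2.2
    omega
  chi_incomparable x hx := by
    -- In the reversed tournament, the out-neighbours of such a `y` inside the out-neighbourhood of
    -- `x` lie in the set measured by `gap y x`.
    have hout : G.chi {y | G.Adj x y ∧ G.gap y x ≤ 4 * t} ≤ C * (4 * t + 1) := by
      rw [← chi_reverse]
      refine chi_le_of_chi_out_le hdom' (X := {y | G.Adj x y}) (Y := ∅) (fun y hy => hy.1)
        (fun y hy => ?_) (by simp)
      rw [chi_reverse]
      refine le_trans (chi_mono ?_) hy.2
      exact fun z hz => ⟨hz.1, adj_asymm (G := G) hz.2.1⟩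
    have hin : G.chi {y | G.Adj y x ∧ G.gap x y ≤ 4 * t} ≤ C * (4 * t + 1) := by
      refine chi_le_of_chi_out_le hdom (X := Set.univ) (Y := {y | G.Adj x y})
        (fun y hy => trivial) (fun y hy => ?_) (fun y hy => adj_asymm hy.1)
      refine le_trans (chi_mono ?_) hy.2
      exact fun z hz => hz.2
    have hsub : {y | y ∈ X ∧ ¬ G.Forward t x y ∧ ¬ G.Forward t y x} ⊆
        ({x} ∪ {y | y ∈ X ∧ (G.Heavy t x y ∨ G.Heavy t y x)}) ∪
          ({y | G.Adj x y ∧ G.gap y x ≤ 4 * t} ∪ {y | G.Adj y x ∧ G.gap x y ≤ 4 * t}) := by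
      rintro y ⟨hyX, h1, h2⟩
      by_cases hyx : y = x
      · exact Or.inl (Or.inl hyx)
      rcases adj_or (G := G) hyx with h | h
      · by_cases ht : t < G.gap y x
        · exact Or.inl (Or.inr ⟨hyX, Or.inr ⟨h, ht⟩⟩)
        · exact Or.inr (Or.inr ⟨h, by
            by_contra h4
            exact h2 ⟨h, by omega, by omega⟩⟩)
      · by_cases ht : t < G.gap x y
        · exact Or.inl (Or.inr ⟨hyX, Or.inl ⟨h, ht⟩⟩)
        · exact Or.inr (Or.inl ⟨h, by
            by_contra h4
            exact h1 ⟨h, by omega, by omega⟩⟩)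
    exact (chi_le_add hsub).trans (Nat.add_le_add
      ((chi_union_le _ _).trans (Nat.add_le_add (chi_singleton_le x) (hheavy x hx)))
      ((chi_union_le _ _).trans (Nat.add_le_add hout hin)))

theorem IsGood.of_induce {X : Set V} {c : ℝ} (h : (G.induce X).IsGood c) : G.IsGood c := by
  obtain ⟨A, B, ⟨hAB, hno⟩, hA, hB⟩ := h
  refine ⟨Subtype.val '' A, Subtype.val '' B,
    ⟨(Set.disjoint_image_iff Subtype.val_injective).2 hAB, ?_⟩, ?_, ?_⟩
  · rintro _ ⟨a, ha, rfl⟩ _ ⟨b, hb, rfl⟩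
    exact hno a ha b hb
  · rwa [← chi_induce]
  · rwa [← chi_induce]

end Gap

/-! ### Excluding heavy cliques and growing witnesses -/

/-- Among tournaments that are not `c`-good and have bounded domination numbers, sets without heavy
cliques of bounded size have bounded chromatic number. -/
theorem exists_chi_le_of_no_heavy_clique {c : ℝ}
    (hc : ∀ l : ℕ, ∃ d : ℕ, ∀ (V : Type u) [Finite V] (G : Tournament V),
      G.AdmitsNumbering l → d ≤ G.chromaticNumber → G.IsGood c) (C t r : ℕ) :
    ∃ f : ℕ, ∀ (V : Type u) [Finite V] (G : Tournament V), ¬ G.IsGood c →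
      (∀ T : Set V, ∃ D : Finset V, (D : Set V) ⊆ T ∧ D.card ≤ C ∧ G.Dominates D T) →
      (∀ T : Set V, ∃ D : Finset V, (D : Set V) ⊆ T ∧ D.card ≤ C ∧ G.reverse.Dominates D T) →
      ∀ X : Set V, (∀ K : Finset V, (K : Set V) ⊆ X → K.card = r →
        ¬ ∀ x ∈ K, ∀ y ∈ K, x ≠ y → G.Heavy t x y ∨ G.Heavy t y x) → G.chi X ≤ f := by
  classical
  induction r with
  | zero => exact ⟨0, fun V _ G _ _ _ X hX => absurd (by simp) (hX ∅ (by simp) rfl)⟩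
  | succ r ih =>
    obtain ⟨f, hf⟩ := ih
    let s := 1 + f + (C * (4 * t + 1) + C * (4 * t + 1))
    obtain ⟨d, hd⟩ := hc (s + 5 * (2 * (C * ((2 * s + 2 * (C * (2 * s + s + 1))) + s + 1))))
    refine ⟨d, fun V _ G hG hdom hdom' X hX => ?_⟩
    by_contra! hlt
    -- A heavy `r`-clique among the heavy neighbours of `x` would extend by `x` to one of size `r +
    -- 1`, so the bound `f` for `r` applies to that neighbourhood.
    have hnear := nearOrder_forward (X := X) (t := t) (s := f) hdom hdom' fun x hx => by
      refine hf V G hG hdom hdom' _ fun K hK hKr hKh => ?_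
      have hxK : x ∉ K := fun h => by
        rcases (hK h).2 with h' | h' <;> exact G.irrefl x h'.1
      refine hX (insert x K) ?_ (by rw [Finset.card_insert_of_notMem hxK, hKr]) ?_
      · rw [Finset.coe_insert]
        exact Set.insert_subset hx fun y hy => (hK hy).1
      · intro y hy z hz hyz
        rcases Finset.mem_insert.1 hy with rfl | hyK
        · rcases Finset.mem_insert.1 hz with rfl | hz
          · exact absurd rfl hyz
          · exact (hK hz).2
        · rcases Finset.mem_insert.1 hz with rfl | hzK
          · exact (hK hyK).2.symm
          · exact hKh y hyK z hzK hyz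
    exact hG (hd X (G.induce X) (hnear.admitsNumbering hdom hdom') hlt.le).of_induce

/-- Tournaments that are not `c`-good and have large chromatic number contain sets of bounded size
and chromatic number at least `k`. -/
def HasBoundedWitnesses (c : ℝ) (k : ℕ) : Prop :=
  ∃ t N : ℕ, ∀ (V : Type u) [Finite V] (G : Tournament V), ¬ G.IsGood c →
    t ≤ G.chromaticNumber → ∃ S : Finset V, S.card ≤ N ∧ k ≤ G.chi (S : Set V)

/-- A complete pair in an induced subtournament is one in `G`, so being bad passes to `G.induce X`.
-/
theorem HasBoundedWitnesses.exists_subset {c : ℝ} {k : ℕ} (h : HasBoundedWitnesses.{u} c k) :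
    ∃ t N : ℕ, ∀ (V : Type u) [Finite V] (G : Tournament V), ¬ G.IsGood c → ∀ X : Set V,
      t ≤ G.chi X → ∃ S : Finset V, (S : Set V) ⊆ X ∧ S.card ≤ N ∧ k ≤ G.chi (S : Set V) := by
  obtain ⟨t, N, h⟩ := h
  refine ⟨t, N, fun V _ G hG X hX => ?_⟩
  obtain ⟨S, hSN, hSk⟩ := h X (G.induce X) (fun h' => hG h'.of_induce) hX
  refine ⟨S.map (Function.Embedding.subtype _), ?_, by rwa [Finset.card_map], ?_⟩
  · intro x hx
    obtain ⟨y, -, rfl⟩ := Finset.mem_map.1 hx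
    exact y.2
  · rw [chi_induce] at hSk
    rw [Finset.coe_map]
    exact hSk

theorem hasBoundedWitnesses_one (c : ℝ) : HasBoundedWitnesses.{u} c 1 := by
  refine ⟨1, 1, fun V _ G _ h => ?_⟩
  rw [← chi_univ] at h
  obtain ⟨x, -⟩ := nonempty_of_chi_pos h
  refine ⟨{x}, by simp, ?_⟩
  by_contra! hlt
  obtain ⟨B, hB, -⟩ := chi_le_iff.1 (Nat.lt_succ_iff.1 hlt)
  obtain ⟨i, -⟩ := Set.mem_iUnion.1 (hB (show x ∈ (({x} : Finset V) : Set V) by simp))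
  exact i.elim0

/-- A large heavy clique, together with sets of chromatic number `k` closing its edges up to
triangles, has chromatic number more than `k`. -/
theorem exists_lt_chi_of_heavy_clique {V : Type u} [Finite V] {G : Tournament V} {k t N : ℕ}
    (hP : ∀ X : Set V, t ≤ G.chi X →
      ∃ S : Finset V, (S : Set V) ⊆ X ∧ S.card ≤ N ∧ k ≤ G.chi (S : Set V))
    {K : Finset V} (hK : K.card = k + 1)
    (hheavy : ∀ x ∈ K, ∀ y ∈ K, x ≠ y → G.Heavy t x y ∨ G.Heavy t y x) :
    ∃ U : Finset V, U.card ≤ (k + 1) + (k + 1) * (k + 1) * N ∧ k < G.chi (U : Set V) := by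
  classical
  have hS : ∀ e : V × V, ∃ S : Finset V, S.card ≤ N ∧ (G.Heavy t e.1 e.2 →
      (S : Set V) ⊆ {z | G.Adj e.2 z ∧ ¬ G.Adj e.1 z} ∧ k ≤ G.chi (S : Set V)) := by
    intro e
    by_cases he : G.Heavy t e.1 e.2
    · obtain ⟨S, h1, h2, h3⟩ := hP _ he.2.le
      exact ⟨S, h2, fun _ => ⟨h1, h3⟩⟩
    · exact ⟨∅, by simp, fun h => absurd h he⟩
  choose S hSN hS using hS
  refine ⟨K ∪ (K ×ˢ K).biUnion S, ?_, ?_⟩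
  · have h1 := Finset.card_union_le K ((K ×ˢ K).biUnion S)
    have h2 := Finset.card_biUnion_le_card_mul (K ×ˢ K) S N fun e _ => hSN e
    rw [Finset.card_product, hK] at h2
    omega
  by_contra! hle
  obtain ⟨B, hB, hB'⟩ := chi_le_iff.1 hle
  have hcol : ∀ x : K, ∃ i, x.1 ∈ B i := fun x =>
    Set.mem_iUnion.1 (hB (Finset.mem_coe.2 (Finset.mem_union_left _ x.2)))
  choose f hf using hcol
  -- Two of the `k + 1` clique vertices share a colour, and the witness attached to the heavy edge
  -- between them meets that colour too.
  obtain ⟨x, y, hxy, hfxy⟩ := Fintype.exists_ne_map_eq_of_card_lt f (by simp [hK])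
  have key : ∀ x y : K, f x = f y → ¬ G.Heavy t x.1 y.1 := by
    intro x y hxy h
    obtain ⟨hsub, hk⟩ := hS (x.1, y.1) h
    obtain ⟨q, hq, hqi⟩ := exists_mem_color hk (fun z hz => hB (Finset.mem_coe.2
      (Finset.mem_union_right _ (Finset.mem_biUnion.2 ⟨(x.1, y.1),
        Finset.mem_product.2 ⟨x.2, y.2⟩, hz⟩)))) hB' (f x)
    obtain ⟨h1, h2⟩ := hsub hq
    have hqx : q ≠ x.1 := fun e => adj_asymm h.1 (e ▸ h1)
    exact (hB' (f x)).no_triangle (hf x) (hxy ▸ hf y) hqi h.1 h1 (adj_of_not_adj hqx h2)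
  rcases hheavy x.1 x.2 y.1 y.2 (fun e => hxy (Subtype.ext e)) with h | h
  · exact key x y hfxy h
  · exact key y x hfxy.symm h

theorem HasBoundedWitnesses.succ {c : ℝ}
    (hc : ∀ l : ℕ, ∃ d : ℕ, ∀ (V : Type u) [Finite V] (G : Tournament V),
      G.AdmitsNumbering l → d ≤ G.chromaticNumber → G.IsGood c) {k : ℕ} (hk : 1 ≤ k)
    (h : HasBoundedWitnesses.{u} c k) : HasBoundedWitnesses.{u} c (k + 1) := by
  obtain ⟨t, N, hP⟩ := h.exists_subset
  let w := k * (t + N + 1)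
  obtain ⟨f, hf⟩ := exists_chi_le_of_no_heavy_clique hc (w + t) t (k + 1)
  -- The size bound covers both forbidden configurations: the one forced by large domination number
  -- and the one built on a heavy clique.
  refine ⟨f + 1, (N + w + 2 ^ w * N) + ((k + 1) + (k + 1) * (k + 1) * N), fun V _ G hG hχ => ?_⟩
  by_contra! hno
  have hno' : ∀ U : Finset V, U.card ≤ N + w + 2 ^ w * N → G.chi (U : Set V) ≤ k := fun U hU =>
    Nat.lt_succ_iff.1 (hno U (by omega))
  have hdom := exists_dominates_card_le hk (w := w) rfl (hP V G hG) hno'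
  have hdom' := exists_dominates_card_le (G := G.reverse) hk (w := w) rfl
    (by simpa only [chi_reverse] using hP V G hG) (by simpa only [chi_reverse] using hno')
  have hle := hf V G hG hdom hdom' Set.univ fun K _ hK hheavy => by
    obtain ⟨U, hU, hUk⟩ := exists_lt_chi_of_heavy_clique (hP V G hG) hK hheavy
    have := hno U (by omega)
    omega
  rw [chi_univ] at hle
  omega

/-- A set of bounded size and chromatic number at least `2 * m` in a tournament of large chromatic
number yields a complete pair with both sides of chromatic number at least `m`. -/
theorem isGood_of_finset {V : Type u} [Finite V] {G : Tournament V} {c : ℝ} {m N : ℕ}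
    (hcm : c ≤ m) {S : Finset V} (hSN : S.card ≤ N) (hS : 2 * m ≤ G.chi (S : Set V))
    (hG : N + 2 ^ N * m < G.chromaticNumber) : G.IsGood c := by
  classical
  -- `T` records which vertices of `S` send an edge to the class, so `T` is complete to the class
  -- and the class is complete to `S \ T`.
  obtain ⟨T, hT, hTm⟩ : ∃ T ∈ S.powerset,
      m < G.chi {z | z ∉ S ∧ ∀ s ∈ S, s ∈ T ↔ G.Adj s z} := by
    by_contra! hcon
    have h1 : G.chi ((S : Set V)ᶜ) ≤ 2 ^ N * m :=
      chi_le_of_subset_biUnion S.powerset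
        (fun T => {z | z ∉ S ∧ ∀ s ∈ S, s ∈ T ↔ G.Adj s z}) (fun z hz => ⟨S.filter fun s => G.Adj s z, by simp,
        hz, fun s hs => by simp [hs]⟩)
        (by rw [Finset.card_powerset]; exact Nat.pow_le_pow_right (by norm_num) hSN) hcon
    have h2 := chi_finset_le_card (G := G) S
    have h3 : G.chi Set.univ ≤ G.chi (S : Set V) + G.chi ((S : Set V)ᶜ) :=
      chi_le_add (by rw [Set.union_compl_self])
    rw [chi_univ] at h3
    omega
  have hTS := Finset.mem_powerset.1 hT
  have hc' : ∀ A : Set V, m ≤ G.chi A → c ≤ (G.chi A : ℝ) := fun A hA =>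
    hcm.trans (by exact_mod_cast hA)
  have hsplit : G.chi (S : Set V) ≤ G.chi (T : Set V) + G.chi ((S : Set V) \ T) :=
    chi_le_add (by rw [Set.union_sdiff_self]; exact Set.subset_union_right)
  rcases le_or_gt m (G.chi (T : Set V)) with h | h
  · refine ⟨T, _, ⟨Set.disjoint_left.2 fun s hs hz => hz.1 (hTS hs), fun s hs z hz => ?_⟩,
      hc' _ h, hc' _ hTm.le⟩
    exact adj_asymm ((hz.2 s (hTS hs)).1 hs)
  · refine ⟨_, (S : Set V) \ T, ⟨Set.disjoint_left.2 fun z hz hs => hz.1 hs.1,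
      fun z hz s hs hadj => hs.2 ((hz.2 s hs.1).2 hadj)⟩, hc' _ hTm.le, hc' _ (by omega)⟩

theorem exists_isGood_of_chromaticNumber_ge {c : ℝ}
    (hc : ∀ l : ℕ, ∃ d : ℕ, ∀ (V : Type u) [Finite V] (G : Tournament V),
      G.AdmitsNumbering l → d ≤ G.chromaticNumber → G.IsGood c) :
    ∃ d : ℕ, ∀ (V : Type u) [Finite V] (G : Tournament V),
      d ≤ G.chromaticNumber → G.IsGood c := by
  have hall : ∀ k, 1 ≤ k → HasBoundedWitnesses.{u} c k := fun k hk => by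
    induction k, hk using Nat.le_induction with
    | base => exact hasBoundedWitnesses_one c
    | succ k hk ih => exact ih.succ hc hk
  -- Only `2 * ⌈c⌉₊` is needed; the extra 1 keeps the index positive when `⌈c⌉₊ = 0`.
  obtain ⟨t, N, h⟩ := hall (2 * ⌈c⌉₊ + 1) (by omega)
  refine ⟨t + (N + 2 ^ N * ⌈c⌉₊ + 1), fun V _ G hG => ?_⟩
  by_contra hgood
  obtain ⟨S, hSN, hS⟩ := h V G hgood (by omega)
  exact hgood (isGood_of_finset (Nat.le_ceil c) hSN (by omega) (by omega))

end Tournament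

theorem mainTheorem9 :
    (∀ c : ℝ, 0 ≤ c →
      (∀ l : ℕ, ∃ d : ℕ, ∀ (V : Type u) [Finite V] (G : Tournament V),
        G.AdmitsNumbering l → d ≤ G.chromaticNumber → G.IsGood c) →
      ∃ d : ℕ, ∀ (V : Type u) [Finite V] (G : Tournament V),
        d ≤ G.chromaticNumber → G.IsGood c) ∧
    ((∀ c : ℝ, 0 ≤ c → ∃ d : ℕ, ∀ (V : Type u) [Finite V] (G : Tournament V),
        d ≤ G.chromaticNumber → G.IsGood c) ↔
      ∀ l : ℕ, ∀ c : ℝ, 0 ≤ c → ∃ d : ℕ, ∀ (V : Type u) [Finite V] (G : Tournament V),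
        G.AdmitsNumbering l → d ≤ G.chromaticNumber → G.IsGood c) := by
  refine ⟨fun c _ hc => Tournament.exists_isGood_of_chromaticNumber_ge hc, fun h l c hc => ?_,
    fun h c hc => Tournament.exists_isGood_of_chromaticNumber_ge fun l => h l c hc⟩
  obtain ⟨d, hd⟩ := h c hc
  exact ⟨d, fun V _ G _ => hd V G⟩
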